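/- **Theorem.** Let $\mathcal B_0^d$ be the family of Borel sets $B\subset\mathbb R^d$ that are bounded away from zero, i.e. $B\subset\{|x|\ge r\}$ for some $r>0$. A *quasi-Lévy type measure* is a function $\nu:\mathcal B_0^d\to\mathbb R$ whose restriction to the Borel subsets of $\{|x|\ge r\}$ is a finite signed measure for every $r>0$, and for which $\int_{\mathbb R^d}(1\wedge|x|^2)\,(\nu^++\nu^-)(dx)<\infty$; here $\nu^\pm$ are the unique measures on $\mathbb R^d$ with $\nu^\pm(\{0\})=0$ that agree on the Borel subsets of $\{|x|\ge r\}$, for every $r>0$, with the positive and negative parts of the Jordan decomposition of the restriction of $\nu$. Integrals with respect to $\nu$ are understood as $\int f\,d\nu=\int f\,d\nu^+-\int f\,d\nu^-$. Let $\mu$ be a quasi-infinitely divisible distribution on $\mathbb R^d$, i.e. a probability distribution whose characteristic function is the quotient of the characteristic functions of two infinitely divisible distributions, and let $(A,\nu,\gamma)$ be its characteristic triplet, i.e. $A\in\mathbb R^{d\times d}$ is symmetric, $\gamma\in\mathbb R^d$, $\nu$ is a quasi-Lévy type measure and, for all $z\in\mathbb R^d$, $$\widehat\mu(z)=\exp\Big(i\langle\gamma,z\rangle-\tfrac12\langle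 z,Az\rangle+\int_{\mathbb R^d}\big(e^{i\langle z,x\rangle}-1-i\langle z,x\rangle\mathbf 1_{[0,1]}(|x|)\big)\,\nu(dx)\Big).$$ For $r>0$ put $$G^-(r)=\sup_{|\xi|=1}\xi^T\Big(\int_{|x|\le r}xx^T\,\nu^-(dx)\Big)\xi,\qquad G^+(r)=\inf_{|\xi|=1}\xi^T\Big(\int_{|x|\le r}xx^T\,\nu^+(dx)\Big)\xi .$$ Suppose that $A$ is strictly positive definite, or that $$\lim_{r\downarrow0}\,r^{-2}\,|\log r|^{-1}\,G^+(r)\left(\frac13-2\,\frac{r^2\,\nu^-(\{x:|x|>r\})}{G^+(r)}-\frac23\,\frac{G^-(r)}{G^+(r)}\right)=\infty$$ (where the expression is interpreted as $0$ if $G^+(r)=0$, so that the condition is violated when $G^+(r)=0$ for small $r$). Then $\mu$ has an infinitely often differentiable Lebesgue density $f\ge 0$ on $\mathbb R^d$ such that $f$ and all its partial derivatives of every order tend to $0$ as $|x|\to\infty$. -/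

import Mathlib

open MeasureTheory Filter Topology Set
open scoped Matrix ContDiff

noncomputable section

namespace QID

/-- Euclidean space of dimension `d`, with the Euclidean norm and inner product. -/
abbrev Euc (d : ℕ) : Type := EuclideanSpace ℝ (Fin d)

/-! ### Infinitely and quasi-infinitely divisible distributions -/

/-- The `n`-fold convolution of a measure with itself (the Dirac mass at `0` for `n = 0`). -/
def convPow {d : ℕ} (ρ : Measure (Euc d)) : ℕ → Measure (Euc d)
  | 0 => Measure.dirac 0
  | n + 1 => (convPow ρ n).conv ρ

/-- A probability distribution is infinitely divisible if for every `n ≥ 1` it is the `n`-fold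
convolution of some probability distribution with itself. -/
def IsInfinitelyDivisible {d : ℕ} (μ : Measure (Euc d)) : Prop :=
  IsProbabilityMeasure μ ∧
    ∀ n : ℕ, 1 ≤ n → ∃ ρ : Measure (Euc d), IsProbabilityMeasure ρ ∧ convPow ρ n = μ

/-- A probability distribution is quasi-infinitely divisible if its characteristic function is
the quotient of the characteristic functions of two infinitely divisible distributions. -/
def IsQuasiInfinitelyDivisible {d : ℕ} (μ : Measure (Euc d)) : Prop :=
  IsProbabilityMeasure μ ∧
    ∃ μ₁ μ₂ : Measure (Euc d), IsInfinitelyDivisible μ₁ ∧ IsInfinitelyDivisible μ₂ ∧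
      ∀ z : Euc d, charFun μ z = charFun μ₁ z / charFun μ₂ z

/-! ### Quasi-Lévy type measures -/

/-- The closed complement `{x : |x| ≥ r}` of the open ball of radius `r`. -/
def outer (d : ℕ) (r : ℝ) : Set (Euc d) := {x | r ≤ ‖x‖}

/-- The Borel sets contained in `{x : |x| ≥ r}`. -/
def borelFrom (d : ℕ) (r : ℝ) : Set (Set (Euc d)) :=
  {B | MeasurableSet B ∧ B ⊆ outer d r}

/-- The Borel sets bounded away from zero. -/
def borelAway (d : ℕ) : Set (Set (Euc d)) :=
  {B | ∃ r : ℝ, 0 < r ∧ B ∈ borelFrom d r}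

theorem measurableSet_outer (d : ℕ) (r : ℝ) : MeasurableSet (outer d r) :=
  measurableSet_le measurable_const measurable_norm

theorem inter_outer_mem {d : ℕ} {r : ℝ} {B : Set (Euc d)} (hB : MeasurableSet B) :
    B ∩ outer d r ∈ borelFrom d r :=
  ⟨hB.inter (measurableSet_outer d r), inter_subset_right⟩

theorem iUnion_mem {d : ℕ} {r : ℝ} {f : ℕ → Set (Euc d)} (hf : ∀ n, f n ∈ borelFrom d r) :
    (⋃ n, f n) ∈ borelFrom d r :=
  ⟨MeasurableSet.iUnion fun n => (hf n).1, iUnion_subset fun n => (hf n).2⟩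

theorem borelFrom_sub {d : ℕ} {r : ℝ} (hr : 0 < r) {B : Set (Euc d)}
    (hB : B ∈ borelFrom d r) : B ∈ borelAway d := ⟨r, hr, hB⟩

/-- A real-valued function on the Borel sets bounded away from zero whose restriction to the
Borel sets in `{x : |x| ≥ r}` is a finite signed measure, for every `r > 0`. -/
structure AwaySignedMeasure (d : ℕ) where
  /-- the set function -/
  toFun : borelAway d → ℝ
  empty : ∀ h : (∅ : Set (Euc d)) ∈ borelAway d, toFun ⟨∅, h⟩ = 0
  iUnion : ∀ (r : ℝ) (hr : 0 < r) (f : ℕ → Set (Euc d)) (hf : ∀ n, f n ∈ borelFrom d r),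
    Pairwise (fun m n => Disjoint (f m) (f n)) →
      HasSum (fun n => toFun ⟨f n, borelFrom_sub hr (hf n)⟩)
        (toFun ⟨⋃ n, f n, borelFrom_sub hr (iUnion_mem hf)⟩)

namespace AwaySignedMeasure

variable {d : ℕ}

open Classical in
/-- The restriction of `ν` to the Borel subsets of `{x : |x| ≥ r}`, regarded as a finite signed
measure on the whole space which is carried by that set. -/
def restr (ν : AwaySignedMeasure d) (r : ℝ) (hr : 0 < r) : SignedMeasure (Euc d) where
  measureOf' B := if h : MeasurableSet B then
    ν.toFun ⟨B ∩ outer d r, borelFrom_sub hr (inter_outer_mem h)⟩ else 0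
  empty' := by
    rw [dif_pos MeasurableSet.empty]
    have h : (∅ : Set (Euc d)) ∈ borelAway d := ⟨1, one_pos, MeasurableSet.empty, by simp⟩
    have : (⟨∅ ∩ outer d r, borelFrom_sub hr (inter_outer_mem MeasurableSet.empty)⟩ :
        borelAway d) = ⟨∅, h⟩ := by ext1; simp
    rw [this]
    exact ν.empty h
  not_measurable' B hB := dif_neg hB
  m_iUnion' f hf hd := by
    rw [dif_pos (MeasurableSet.iUnion hf)]
    have key := ν.iUnion r hr (fun n => f n ∩ outer d r) (fun n => inter_outer_mem (hf n))
      (fun m n hmn => (hd hmn).mono inter_subset_left inter_subset_left)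
    convert key using 1
    · funext n
      rw [dif_pos (hf n)]
    · congr 2
      exact iUnion_inter _ _

open Classical in
theorem restr_apply (ν : AwaySignedMeasure d) {r : ℝ} (hr : 0 < r) {B : Set (Euc d)}
    (hB : B ∈ borelFrom d r) : ν.restr r hr B = ν.toFun ⟨B, borelFrom_sub hr hB⟩ := by
  have : ν.restr r hr B = if h : MeasurableSet B then
    ν.toFun ⟨B ∩ outer d r, borelFrom_sub hr (inter_outer_mem h)⟩ else 0 := rfl
  rw [this, dif_pos hB.1]
  congr 2
  exact inter_eq_left.2 hB.2

/-- The Jordan decomposition of the restriction of `ν` to `{x : |x| ≥ r}`. -/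
def jordan (ν : AwaySignedMeasure d) (r : ℝ) (hr : 0 < r) : JordanDecomposition (Euc d) :=
  (ν.restr r hr).toJordanDecomposition

/-- The sets `{x : 1 ≤ |x|}` and `{x : 1 / (n + 1) ≤ |x| < 1 / n}` for `n ≥ 1`. -/
def shell (d : ℕ) : ℕ → Set (Euc d) :=
  disjointed fun n => outer d (1 / ((n : ℝ) + 1))

/-- The positive part of `ν`: the unique measure without mass at `0` which agrees on the Borel
subsets of `{x : |x| ≥ r}` with the positive part of the restriction of `ν`, for every `r > 0`
(see `posPart_zero`, `posPart_apply` and `eq_posPart`). -/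
def posPart (ν : AwaySignedMeasure d) : Measure (Euc d) :=
  Measure.sum fun n : ℕ =>
    (ν.jordan (1 / ((n : ℝ) + 1)) Nat.one_div_pos_of_nat).posPart.restrict (shell d n)

/-- The negative part of `ν`: the unique measure without mass at `0` which agrees on the Borel
subsets of `{x : |x| ≥ r}` with the negative part of the restriction of `ν`, for every `r > 0`
(see `negPart_zero`, `negPart_apply` and `eq_negPart`). -/
def negPart (ν : AwaySignedMeasure d) : Measure (Euc d) :=
  Measure.sum fun n : ℕ =>
    (ν.jordan (1 / ((n : ℝ) + 1)) Nat.one_div_pos_of_nat).negPart.restrict (shell d n)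

/-- The total variation of `ν`. -/
def totalVariation (ν : AwaySignedMeasure d) : Measure (Euc d) := ν.posPart + ν.negPart

/-- Integrability of a function with respect to `ν`. -/
def Integrable (ν : AwaySignedMeasure d) (f : Euc d → ℂ) : Prop :=
  MeasureTheory.Integrable f ν.totalVariation

/-- The integral of an integrable function with respect to `ν`. -/
def integral (ν : AwaySignedMeasure d) (f : Euc d → ℂ) : ℂ :=
  (∫ x, f x ∂ν.posPart) - ∫ x, f x ∂ν.negPart

/-- `ν` is a quasi-Lévy type measure if `x ↦ min 1 |x|²` is integrable with respect to `ν`. -/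
def IsQuasiLevyType (ν : AwaySignedMeasure d) : Prop :=
  ν.Integrable fun x => ((min 1 (‖x‖ ^ 2) : ℝ) : ℂ)

/-! #### The defining properties of the positive and negative part -/

open Classical in
theorem jordan_mono (ν : AwaySignedMeasure d) {r s : ℝ} (hr : 0 < r) (hs : 0 < s) (h : r ≤ s) :
    (ν.jordan s hs).posPart = (ν.jordan r hr).posPart.restrict (outer d s) ∧
      (ν.jordan s hs).negPart = (ν.jordan r hr).negPart.restrict (outer d s) := by
  have hm := measurableSet_outer d s
  let j : JordanDecomposition (Euc d) :=
    { posPart := (ν.jordan r hr).posPart.restrict (outer d s)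
      negPart := (ν.jordan r hr).negPart.restrict (outer d s)
      mutuallySingular := ((ν.jordan r hr).mutuallySingular.restrict _).symm.restrict _ |>.symm }
  have hj : ν.restr s hs = j.toSignedMeasure := by
    ext B hB
    have e1 : ν.restr s hs B = ν.restr r hr (B ∩ outer d s) := by
      have h1 : B ∩ outer d s ∈ borelFrom d s := inter_outer_mem hB
      have h2 : B ∩ outer d s ∈ borelFrom d r :=
        ⟨h1.1, fun x hx => h.trans (h1.2 hx)⟩
      rw [restr_apply ν hr h2]
      change dite _ _ _ = _
      rw [dif_pos hB]
    have e2 := SignedMeasure.apply_eq_posPart_real_sub_negPart_real (ν.restr r hr) (hB.inter hm)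
    rw [e1, e2, JordanDecomposition.toSignedMeasure, Measure.toSignedMeasure_sub_apply hB]
    simp only [j, jordan, measureReal_def, Measure.restrict_apply hB]
  have := SignedMeasure.toJordanDecomposition_eq hj
  simp only [jordan] at this ⊢
  rw [this]
  exact ⟨rfl, rfl⟩

theorem jordan_congr (ν : AwaySignedMeasure d) {r s : ℝ} (hr : 0 < r) (hs : 0 < s)
    {B : Set (Euc d)} (hBr : B ∈ borelFrom d r) (hBs : B ∈ borelFrom d s) :
    (ν.jordan r hr).posPart B = (ν.jordan s hs).posPart B ∧
      (ν.jordan r hr).negPart B = (ν.jordan s hs).negPart B := by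
  rcases le_total r s with h | h
  · obtain ⟨h1, h2⟩ := ν.jordan_mono hr hs h
    rw [h1, h2, Measure.restrict_apply hBs.1, Measure.restrict_apply hBs.1,
      inter_eq_left.2 hBs.2]
    exact ⟨rfl, rfl⟩
  · obtain ⟨h1, h2⟩ := ν.jordan_mono hs hr h
    rw [h1, h2, Measure.restrict_apply hBr.1, Measure.restrict_apply hBr.1,
      inter_eq_left.2 hBr.2]
    exact ⟨rfl, rfl⟩

theorem shell_subset (n : ℕ) : shell d n ⊆ outer d (1 / ((n : ℝ) + 1)) :=
  disjointed_subset _ n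

theorem measurableSet_shell (n : ℕ) : MeasurableSet (shell d n) :=
  MeasurableSet.disjointed (fun _ => measurableSet_outer d _) n

theorem subset_iUnion_shell {r : ℝ} (hr : 0 < r) {B : Set (Euc d)} (hB : B ⊆ outer d r) :
    B ⊆ ⋃ n, shell d n := by
  intro x hx
  rw [shell, iUnion_disjointed]
  obtain ⟨n, hn⟩ := exists_nat_one_div_lt hr
  exact mem_iUnion.2 ⟨n, hn.le.trans (hB hx)⟩

theorem sum_shell (m : Measure (Euc d)) {r : ℝ} (hr : 0 < r) {B : Set (Euc d)}
    (hB : B ∈ borelFrom d r) : ∑' n, m (B ∩ shell d n) = m B := by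
  rw [← measure_iUnion, ← inter_iUnion, inter_eq_left.2 (subset_iUnion_shell hr hB.2)]
  · intro i j hij
    exact (disjoint_disjointed _ hij).mono inter_subset_right inter_subset_right
  · exact fun n => hB.1.inter (measurableSet_shell n)

theorem posPart_apply (ν : AwaySignedMeasure d) {r : ℝ} (hr : 0 < r) {B : Set (Euc d)}
    (hB : B ∈ borelFrom d r) :
    ν.posPart B = (ν.restr r hr).toJordanDecomposition.posPart B := by
  rw [posPart, Measure.sum_apply _ hB.1, ← sum_shell _ hr hB]
  refine tsum_congr fun n => ?_
  rw [Measure.restrict_apply hB.1]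
  exact (ν.jordan_congr _ hr
    ⟨hB.1.inter (measurableSet_shell n), inter_subset_right.trans (shell_subset n)⟩
    ⟨hB.1.inter (measurableSet_shell n), inter_subset_left.trans hB.2⟩).1

theorem negPart_apply (ν : AwaySignedMeasure d) {r : ℝ} (hr : 0 < r) {B : Set (Euc d)}
    (hB : B ∈ borelFrom d r) :
    ν.negPart B = (ν.restr r hr).toJordanDecomposition.negPart B := by
  rw [negPart, Measure.sum_apply _ hB.1, ← sum_shell _ hr hB]
  refine tsum_congr fun n => ?_
  rw [Measure.restrict_apply hB.1]
  exact (ν.jordan_congr _ hr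
    ⟨hB.1.inter (measurableSet_shell n), inter_subset_right.trans (shell_subset n)⟩
    ⟨hB.1.inter (measurableSet_shell n), inter_subset_left.trans hB.2⟩).2

theorem zero_inter_shell (n : ℕ) : ({0} : Set (Euc d)) ∩ shell d n = ∅ := by
  ext x
  simp only [mem_inter_iff, mem_singleton_iff, mem_empty_iff_false, iff_false, not_and]
  rintro rfl hx
  have h := shell_subset n hx
  simp only [outer, mem_ofPred_eq, norm_zero] at h
  exact absurd h (not_le.2 Nat.one_div_pos_of_nat)

theorem posPart_zero (ν : AwaySignedMeasure d) : ν.posPart {0} = 0 := by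
  rw [posPart, Measure.sum_apply _ (measurableSet_singleton _)]
  simp [Measure.restrict_apply, zero_inter_shell]

theorem negPart_zero (ν : AwaySignedMeasure d) : ν.negPart {0} = 0 := by
  rw [negPart, Measure.sum_apply _ (measurableSet_singleton _)]
  simp [Measure.restrict_apply, zero_inter_shell]

theorem ext_away {m m' : Measure (Euc d)} (h0 : m {0} = m' {0})
    (h : ∀ r : ℝ, 0 < r → ∀ B ∈ borelFrom d r, m B = m' B) : m = m' := by
  have key : ∀ (k : Measure (Euc d)) (B : Set (Euc d)), MeasurableSet B →
      k B = k (B ∩ {0}) + ∑' n, k (B ∩ shell d n) := by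
    intro k B hB
    rw [← measure_inter_add_sdiff B (measurableSet_singleton (0 : Euc d)), ← measure_iUnion,
      ← inter_iUnion]
    · congr 2
      ext x
      simp only [Set.mem_sdiff, mem_singleton_iff, mem_inter_iff, and_congr_right_iff]
      intro _
      constructor
      · intro hx
        exact subset_iUnion_shell (norm_pos_iff.2 hx) (B := {x}) (by simp [outer]) rfl
      · rintro hx rfl
        obtain ⟨n, hn⟩ := mem_iUnion.1 hx
        exact (zero_inter_shell (d := d) n).subset ⟨rfl, hn⟩
    · intro i j hij
      exact (disjoint_disjointed _ hij).mono inter_subset_right inter_subset_right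
    · exact fun n => hB.inter (measurableSet_shell n)
  ext B hB
  rw [key m B hB, key m' B hB]
  congr 1
  · by_cases hx : (0 : Euc d) ∈ B
    · rw [inter_eq_right.2 (singleton_subset_iff.2 hx), h0]
    · rw [inter_singleton_eq_empty.2 hx, measure_empty, measure_empty]
  · exact tsum_congr fun n => h _ Nat.one_div_pos_of_nat _
      ⟨hB.inter (measurableSet_shell n), inter_subset_right.trans (shell_subset n)⟩

theorem eq_posPart (ν : AwaySignedMeasure d) {m : Measure (Euc d)} (h0 : m {0} = 0)
    (h : ∀ (r : ℝ) (hr : 0 < r), ∀ B ∈ borelFrom d r,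
      m B = (ν.restr r hr).toJordanDecomposition.posPart B) : m = ν.posPart :=
  ext_away (h0.trans ν.posPart_zero.symm) fun r hr B hB =>
    (h r hr B hB).trans (ν.posPart_apply hr hB).symm

theorem eq_negPart (ν : AwaySignedMeasure d) {m : Measure (Euc d)} (h0 : m {0} = 0)
    (h : ∀ (r : ℝ) (hr : 0 < r), ∀ B ∈ borelFrom d r,
      m B = (ν.restr r hr).toJordanDecomposition.negPart B) : m = ν.negPart :=
  ext_away (h0.trans ν.negPart_zero.symm) fun r hr B hB =>
    (h r hr B hB).trans (ν.negPart_apply hr hB).symm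

end AwaySignedMeasure

/-! ### The Lévy-Khintchine representation -/

/-- The standard representation function `x ↦ x 1_{[0,1]}(|x|)`. -/
def stdRep {d : ℕ} (x : Euc d) : Euc d := if ‖x‖ ≤ 1 then x else 0

/-- The quadratic form `ξᵀ M ξ`. -/
def quadForm {d : ℕ} (M : Matrix (Fin d) (Fin d) ℝ) (ξ : Euc d) : ℝ :=
  ξ.ofLp ⬝ᵥ M *ᵥ ξ.ofLp

/-- The characteristic exponent
`i⟨γ,z⟩ - ⟨z,Az⟩/2 + ∫ (exp(i⟨z,x⟩) - 1 - i⟨z,x⟩ 1_{[0,1]}(|x|)) ν(dx)`. -/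
def charExponent {d : ℕ} (A : Matrix (Fin d) (Fin d) ℝ) (ν : AwaySignedMeasure d) (γ : Euc d)
    (z : Euc d) : ℂ :=
  Complex.I * (inner ℝ γ z : ℝ) - (1 / 2 : ℂ) * (quadForm A z : ℝ)
    + ν.integral fun x =>
        Complex.exp (Complex.I * (inner ℝ z x : ℝ)) - 1 - Complex.I * (inner ℝ z (stdRep x) : ℝ)

/-- `(A, ν, γ)` is the standard characteristic triplet of `μ`: the matrix `A` is symmetric, `ν` is
a quasi-Lévy type measure, and the characteristic function of `μ` has the Lévy-Khintchine
representation with `A`, `ν` and `γ`. -/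
structure HasCharacteristicTriplet {d : ℕ} (μ : Measure (Euc d)) (A : Matrix (Fin d) (Fin d) ℝ)
    (ν : AwaySignedMeasure d) (γ : Euc d) : Prop where
  symm : A.IsSymm
  levy : ν.IsQuasiLevyType
  charFun_eq : ∀ z : Euc d, charFun μ z = Complex.exp (charExponent A ν γ z)

/-! ### The Kallenberg-type condition -/

/-- The matrix `∫_{|x| ≤ r} x xᵀ m(dx)`. -/
def truncMoment {d : ℕ} (m : Measure (Euc d)) (r : ℝ) : Matrix (Fin d) (Fin d) ℝ :=
  Matrix.of fun i j => ∫ x in {x : Euc d | ‖x‖ ≤ r}, x i * x j ∂m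

/-- `G⁻(r)`, the supremum of `ξᵀ (∫_{|x| ≤ r} x xᵀ ν⁻(dx)) ξ` over the unit sphere. -/
def Gminus {d : ℕ} (ν : AwaySignedMeasure d) (r : ℝ) : ℝ :=
  ⨆ ξ : Metric.sphere (0 : Euc d) 1, quadForm (truncMoment ν.negPart r) (ξ : Euc d)

/-- `G⁺(r)`, the infimum of `ξᵀ (∫_{|x| ≤ r} x xᵀ ν⁺(dx)) ξ` over the unit sphere. -/
def Gplus {d : ℕ} (ν : AwaySignedMeasure d) (r : ℝ) : ℝ :=
  ⨅ ξ : Metric.sphere (0 : Euc d) 1, quadForm (truncMoment ν.posPart r) (ξ : Euc d)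

/-- The condition
`r⁻² |log r|⁻¹ G⁺(r) (1/3 - 2 r² ν⁻(|x| > r) / G⁺(r) - (2/3) G⁻(r) / G⁺(r)) → ∞` as `r ↓ 0`.
Where `G⁺(r) = 0`, the expression has the value `0`, so that the condition is violated when
`G⁺(r) = 0` for small `r`. -/
def KallenbergCondition {d : ℕ} (ν : AwaySignedMeasure d) : Prop :=
  Tendsto (fun r : ℝ => (r ^ 2)⁻¹ * |Real.log r|⁻¹ * Gplus ν r *
      (1 / 3 - 2 * (r ^ 2 * ν.negPart.real {x : Euc d | r < ‖x‖} / Gplus ν r)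
        - 2 / 3 * (Gminus ν r / Gplus ν r)))
    (𝓝[>] 0) atTop

end QID

end

/-! It suffices that the characteristic function decays faster than every power of `‖z‖`: Fourier
inversion then yields a smooth density, and Riemann–Lebesgue, applied to each derivative, yields the
vanishing at infinity (`exists_contDiff_density_of_integrable_charFun`). The modulus of the
characteristic function is the exponential of -⟨z,Az⟩/2 - ∫(1 - cos⟨z,x⟩)dν⁺ + ∫(1 - cos⟨z,x⟩)dν⁻,
and this has to drop below -n log‖z‖ for every n. Each of the two integrals is o(‖z‖²)
(`exists_tendsto_zero_bound_one_sub_cos`), so a positive definite A wins at once. The same estimate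
and the bound 1 on the characteristic function force A ≥ 0 in general, so the Gaussian term never
hurts. Under the Kallenberg condition take r = 1/‖z‖. The ν⁺ integral is at least ‖z‖²G⁺(r)/3
(`le_integral_one_sub_cos`), the ν⁻ integral at most ‖z‖²G⁻(r)/2 + 2ν⁻(|x| > r)
(`integral_one_sub_cos_le`), and the condition says that the difference outgrows every multiple of
log‖z‖. -/

/-! ### Measures determined by smooth test functions -/

/-- Two locally finite measures with the same integrals of smooth compactly supported functions
coincide. -/
theorem MeasureTheory.Measure.ext_of_integral_contDiff {E : Type*} [NormedAddCommGroup E]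
    [NormedSpace ℝ E] [FiniteDimensional ℝ E] [MeasurableSpace E] [BorelSpace E]
    {μ ν : Measure E} [IsLocallyFiniteMeasure μ] [IsLocallyFiniteMeasure ν]
    (h : ∀ g : E → ℝ, ContDiff ℝ ∞ g → HasCompactSupport g → ∫ x, g x ∂μ = ∫ x, g x ∂ν) :
    μ = ν := by
  have := FiniteDimensional.proper_real E
  have key : ∀ {μ ν : Measure E} [IsLocallyFiniteMeasure μ] [IsLocallyFiniteMeasure ν],
      (∀ g : E → ℝ, ContDiff ℝ ∞ g → HasCompactSupport g → ∫ x, g x ∂μ = ∫ x, g x ∂ν) →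
      ∀ K : Set E, IsCompact K → μ K ≤ ν K := by
    intro μ ν _ _ h K hK
    rw [K.measure_eq_iInf_isOpen ν]
    refine le_iInf₂ fun U hKU => le_iInf fun hU => ?_
    -- `U` may be unbounded; intersecting it with a bounded neighbourhood of `K` makes the support
    -- of `g` relatively compact.
    obtain ⟨g, hg, hr, hs, h1⟩ := exists_contMDiff_support_eq_eq_one_iff (n := ⊤)
      (modelWithCornersSelf ℝ E)
      (hU.inter (Metric.isOpen_thickening (δ := 1) (E := K))) hK.isClosed
      (subset_inter hKU (Metric.self_subset_thickening one_pos K))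
    have hc : HasCompactSupport g := by
      refine HasCompactSupport.of_support_subset_isCompact (hK.cthickening (r := 1)) ?_
      rw [hs]
      exact inter_subset_right.trans (Metric.thickening_subset_cthickening _ _)
    have hgc : Continuous g := hg.contDiff.continuous
    have hr' : ∀ x, 0 ≤ g x ∧ g x ≤ 1 := fun x => hr (mem_range_self x)
    have e := h g hg.contDiff hc
    have hiμ : Integrable g μ := hgc.integrable_of_hasCompactSupport hc
    have hiν : Integrable g ν := hgc.integrable_of_hasCompactSupport hc
    have e' : ∫⁻ x, ENNReal.ofReal (g x) ∂μ = ∫⁻ x, ENNReal.ofReal (g x) ∂ν := by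
      rw [← ofReal_integral_eq_lintegral_ofReal hiμ (ae_of_all _ fun x => (hr' x).1),
        ← ofReal_integral_eq_lintegral_ofReal hiν (ae_of_all _ fun x => (hr' x).1), e]
    calc μ K = ∫⁻ x, K.indicator 1 x ∂μ := (lintegral_indicator_one hK.measurableSet).symm
      _ ≤ ∫⁻ x, ENNReal.ofReal (g x) ∂μ := by
        refine lintegral_mono fun x => ?_
        by_cases hx : x ∈ K
        · simp [hx, (h1 x).1 hx]
        · simp [hx]
      _ = ∫⁻ x, ENNReal.ofReal (g x) ∂ν := e'
      _ ≤ ∫⁻ x, U.indicator 1 x ∂ν := by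
        refine lintegral_mono fun x => ?_
        by_cases hx : x ∈ U
        · simpa [hx] using (hr' x).2
        · have : g x = 0 := by
            by_contra h0
            have : x ∈ Function.support g := h0
            rw [hs] at this
            exact hx this.1
          simp [this]
      _ = ν U := lintegral_indicator_one hU.measurableSet
  have hle : ∀ {μ ν : Measure E} [IsLocallyFiniteMeasure μ] [IsLocallyFiniteMeasure ν],
      (∀ K : Set E, IsCompact K → μ K ≤ ν K) → μ ≤ ν := by
    intro μ ν _ _ hK
    refine Measure.le_iff.2 fun B hB => ?_
    rw [MeasurableSet.measure_eq_iSup_isCompact hB μ]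
    exact iSup₂_le fun K hKB => iSup_le fun hKc => (hK K hKc).trans (measure_mono hKB)
  exact le_antisymm (hle (key h)) (hle (key fun g hg hgc => (h g hg hgc).symm))

/-! ### Fourier inversion and smooth densities -/

/-- Reconciles two normalisations: `charFun` has kernel exp(i⟨x,ξ⟩), the Fourier integral
exp(-2πi⟨x,ξ⟩). -/
theorem charFun_neg_two_pi_smul {V : Type*} [NormedAddCommGroup V] [InnerProductSpace ℝ V]
    [MeasurableSpace V] (μ : Measure V) (ξ : V) :
    charFun μ (-(2 * Real.pi) • ξ)
      = VectorFourier.fourierIntegral Real.fourierChar μ (innerₗ V) 1 ξ := by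
  rw [charFun_eq_fourierIntegral']
  congr 1
  rw [smul_smul]
  have := Real.pi_ne_zero
  field_simp
  simp

section Fourier

open scoped FourierTransform

variable {V : Type*} [NormedAddCommGroup V] [InnerProductSpace ℝ V] [FiniteDimensional ℝ V]
  [MeasurableSpace V] [BorelSpace V]

/-- Fourier inversion for finite measures, tested against Schwartz functions. -/
theorem integral_smul_fourierInv_charFun (μ : Measure V) [IsFiniteMeasure μ]
    (hG : Integrable fun ξ : V => charFun μ (-(2 * Real.pi) • ξ)) (φ : SchwartzMap V ℂ) :
    ∫ x, 𝓕⁻ (fun ξ : V => charFun μ (-(2 * Real.pi) • ξ)) x • φ x = ∫ x, φ x ∂μ := by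
  set G : V → ℂ := fun ξ : V => charFun μ (-(2 * Real.pi) • ξ) with hGdef
  have hG' : G = VectorFourier.fourierIntegral Real.fourierChar μ (innerₗ V) 1 :=
    funext fun ξ => charFun_neg_two_pi_smul μ ξ
  have h1 : ∫ x, 𝓕⁻ G x • φ x = ∫ ξ, G ξ • (𝓕⁻ φ : SchwartzMap V ℂ) ξ := by
    -- The multiplication formula for the pairing -⟨x,ξ⟩, whose transform is `𝓕⁻`, moves `𝓕⁻` from
    -- `G` onto `φ`.
    have := VectorFourier.integral_fourierIntegral_smul_eq_flip (L := -innerₗ V)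
      (μ := volume) (ν := volume) (f := G) (g := φ) Real.continuous_fourierChar
      (continuous_inner (𝕜 := ℝ) (E := V)).neg hG φ.integrable
    have hflip : (-innerₗ V).flip = -innerₗ V := by
      ext x y; simp [real_inner_comm]
    rw [hflip] at this
    rw [SchwartzMap.fourierInv_coe]
    exact this
  have h2 : ∫ ξ, G ξ • (𝓕⁻ φ : SchwartzMap V ℂ) ξ = ∫ x, φ x ∂μ := by
    -- The same formula again, with `μ` entering as the constant function 1 on the space with
    -- measure `μ`; its transform is `G`.
    have := VectorFourier.integral_fourierIntegral_smul_eq_flip (L := innerₗ V)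
      (μ := μ) (ν := volume) (f := 1) (g := (𝓕⁻ φ : SchwartzMap V ℂ)) Real.continuous_fourierChar
      (by simpa using continuous_inner (𝕜 := ℝ) (E := V)) (integrable_const (1 : ℂ))
      (𝓕⁻ φ : SchwartzMap V ℂ).integrable
    rw [← hG', flip_innerₗ] at this
    rw [this]
    refine integral_congr_ae (ae_of_all _ fun x => ?_)
    have h3 : (𝓕 (𝓕⁻ φ : SchwartzMap V ℂ) : SchwartzMap V ℂ) x = φ x := by rw [FourierTransform.fourier_fourierInv_eq]
    rw [SchwartzMap.fourier_coe] at h3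
    rw [← h3]
    simp only [Pi.one_apply, one_smul]
    rfl
  exact h1.trans h2

/-- A finite measure whose characteristic function has integrable moments of all orders has a
smooth density all of whose derivatives vanish at infinity. -/
theorem exists_contDiff_density_of_integrable_charFun (μ : Measure V) [IsFiniteMeasure μ]
    (hμ : ∀ n : ℕ, Integrable fun ξ : V => ‖ξ‖ ^ n * ‖charFun μ ξ‖) :
    ∃ f : V → ℝ, (∀ x, 0 ≤ f x) ∧ ContDiff ℝ ∞ f ∧
      μ = volume.withDensity (fun x => ENNReal.ofReal (f x)) ∧
      ∀ k : ℕ, Tendsto (fun x => iteratedFDeriv ℝ k f x) (cocompact V) (𝓝 0) := by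
  -- The sign is opposite to that in the inversion lemma, so that `𝓕 H` is the inverse transform
  -- needed and the results on derivatives of `𝓕` apply directly.
  set H : V → ℂ := fun ξ : V => charFun μ ((2 * Real.pi) • ξ) with hH
  have hpi : (2 * Real.pi) ≠ 0 := by positivity
  have hHm : ∀ n : ℕ, Integrable fun ξ : V => ‖ξ‖ ^ n * ‖H ξ‖ := by
    intro n
    have := ((hμ n).comp_smul hpi).const_mul (((2 * Real.pi) ^ n)⁻¹)
    refine this.congr (ae_of_all _ fun ξ => ?_)
    simp only [hH, norm_smul, mul_pow, Real.norm_eq_abs, abs_of_pos (by positivity : 0 < 2 * Real.pi)]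
    field_simp
  have hmeas : AEStronglyMeasurable H volume :=
    ((stronglyMeasurable_charFun (μ := μ)).comp_measurable
      (measurable_const_smul (2 * Real.pi))).aestronglyMeasurable
  have hHi : Integrable H := by
    have := hHm 0
    simp only [pow_zero, one_mul] at this
    exact (integrable_norm_iff hmeas).1 this
  set F : V → ℂ := 𝓕 H with hF
  have hFs : ContDiff ℝ ∞ F := Real.contDiff_fourier (N := ⊤) fun n _ => hHm n
  have hFd : ∀ k : ℕ, Tendsto (fun x => iteratedFDeriv ℝ k F x) (cocompact V) (𝓝 0) := by
    intro k
    rw [hF, Real.iteratedFDeriv_fourier (N := ⊤) (fun n _ => hHm n) hmeas le_top]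
    -- Each derivative is again a Fourier transform, so this is Riemann–Lebesgue.
    exact tendsto_integral_exp_inner_smul_cocompact _
  have hFφ : ∀ φ : SchwartzMap V ℂ, ∫ x, F x • φ x = ∫ x, φ x ∂μ := by
    intro φ
    have e : (fun ξ : V => charFun μ (-(2 * Real.pi) • ξ)) = fun ξ => H (-ξ) := by
      ext ξ; simp [hH]
    have := integral_smul_fourierInv_charFun μ (by rw [e]; exact hHi.comp_neg) φ
    rw [e, Real.fourierInv_eq_fourier_comp_neg] at this
    simpa only [neg_neg] using this
  -- The imaginary part need not be shown to vanish: real test functions see only the real part.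
  set f : V → ℝ := fun x => (F x).re with hf
  have hfs : ContDiff ℝ ∞ f := Complex.reCLM.contDiff.comp hFs
  have hfφ : ∀ g : V → ℝ, ContDiff ℝ ∞ g → HasCompactSupport g →
      ∫ x, g x * f x = ∫ x, g x ∂μ := by
    intro g hg hgc
    have hg' : ContDiff ℝ ∞ fun x => (g x : ℂ) := Complex.ofRealCLM.contDiff.comp hg
    have hgc' : HasCompactSupport fun x => (g x : ℂ) := hgc.comp_left Complex.ofReal_zero
    have h1 := hFφ (hgc'.toSchwartzMap hg')
    have hi : Integrable fun x => F x • (g x : ℂ) :=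
      (hFs.continuous.smul hg'.continuous).integrable_of_hasCompactSupport hgc'.smul_left
    have h2 := congrArg Complex.re h1
    simp only [HasCompactSupport.toSchwartzMap_toFun] at h2
    have h3 : ∫ x, (g x : ℂ) ∂μ = ((∫ x, g x ∂μ : ℝ) : ℂ) := integral_ofReal
    rw [h3, Complex.ofReal_re] at h2
    rw [← h2, ← RCLike.re_eq_complex_re, ← integral_re hi]
    refine integral_congr_ae (ae_of_all _ fun x => ?_)
    simp [hf, mul_comm]
  have hf0 : ∀ x, 0 ≤ f x := by
    intro x
    by_contra! hx
    have hU : {y | f y < 0} ∈ 𝓝 x := hfs.continuous.continuousAt.eventually_lt_const hx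
    -- A bump supported where `f < 0` would have a negative integral against `f`, yet a nonnegative
    -- one against `μ`.
    obtain ⟨g, hsupp, hgc, hg, hr, hgx⟩ := exists_contDiff_tsupport_subset (n := ⊤) hU
    have hg' : ∀ y, 0 ≤ g y := fun y => (hr (mem_range_self y)).1
    have h1 : 0 ≤ ∫ y, g y * f y := by
      rw [hfφ g hg hgc]
      exact integral_nonneg hg'
    have hgf : ∀ y, g y * f y ≤ 0 := by
      intro y
      by_cases hy : y ∈ tsupport g
      · exact mul_nonpos_of_nonneg_of_nonpos (hg' y) (le_of_lt (hsupp hy))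
      · simp [image_eq_zero_of_notMem_tsupport hy]
    have hcont : Continuous fun y => g y * f y := hg.continuous.mul hfs.continuous
    have h2 : 0 < ∫ y, -(g y * f y) :=
      hcont.neg.integral_pos_of_hasCompactSupport_nonneg_nonzero (hgc.mul_right.neg)
        (fun y => neg_nonneg.2 (hgf y)) (x := x) (by simp [hgx, hx.ne])
    rw [integral_neg] at h2
    linarith
  refine ⟨f, hf0, hfs, ?_, ?_⟩
  · have hcn : Continuous fun x => (f x).toNNReal :=
      continuous_real_toNNReal.comp hfs.continuous
    -- Continuity of `f` suffices here; its integrability is not yet known.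
    have : IsLocallyFiniteMeasure (volume.withDensity fun x => ENNReal.ofReal (f x)) :=
      IsLocallyFiniteMeasure.withDensity_coe hcn
    refine Measure.ext_of_integral_contDiff fun g hg hgc => ?_
    rw [← hfφ g hg hgc]
    have := integral_withDensity_eq_integral_smul (μ := (volume : Measure V)) hcn.measurable g
    refine Eq.trans ?_ this.symm
    refine integral_congr_ae (ae_of_all _ fun x => ?_)
    simp [NNReal.smul_def, hf0 x, mul_comm]
  · intro k
    have e : (fun x => iteratedFDeriv ℝ k f x) = fun x =>
        Complex.reCLM.compContinuousMultilinearMap (iteratedFDeriv ℝ k F x) := by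
      ext1 x
      exact Complex.reCLM.iteratedFDeriv_comp_left (hFs.contDiffAt)
        (by exact_mod_cast le_top)
    rw [e]
    have hc : Continuous fun m : ContinuousMultilinearMap ℝ (fun _ : Fin k => V) ℂ =>
        Complex.reCLM.compContinuousMultilinearMap m :=
      (ContinuousLinearMap.compContinuousMultilinearMapL ℝ (fun _ : Fin k => V) ℂ ℝ
        Complex.reCLM).continuous
    have := (hc.tendsto 0).comp (hFd k)
    have h0 : Complex.reCLM.compContinuousMultilinearMap
        (0 : ContinuousMultilinearMap ℝ (fun _ : Fin k => V) ℂ) = 0 := by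
      ext; simp
    rwa [h0] at this

end Fourier

namespace QID

open scoped InnerProductSpace

variable {d : ℕ}

/-! ### Elementary inequalities -/

theorem inner_sq_le (z x : Euc d) : ⟪z, x⟫_ℝ ^ 2 ≤ ‖z‖ ^ 2 * ‖x‖ ^ 2 := by
  rw [← mul_pow, ← sq_abs]
  exact pow_le_pow_left₀ (abs_nonneg _) (abs_real_inner_le_norm z x) 2

theorem one_sub_cos_nonneg (u : ℝ) : 0 ≤ 1 - Real.cos u := sub_nonneg.2 (Real.cos_le_one u)

theorem one_sub_cos_le_two (u : ℝ) : 1 - Real.cos u ≤ 2 := by linarith [Real.neg_one_le_cos u]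

theorem one_sub_cos_le_sq (u : ℝ) : 1 - Real.cos u ≤ u ^ 2 / 2 := by
  linarith [Real.one_sub_sq_div_two_le_cos (x := u)]

/-- The quartic Taylor error costs at most 5u²/96 when |u| ≤ 1. The factor 1/3 is the one in the
Kallenberg condition. -/
theorem sq_div_three_le_one_sub_cos {u : ℝ} (hu : |u| ≤ 1) : u ^ 2 / 3 ≤ 1 - Real.cos u := by
  have h := (abs_le.1 (Real.cos_bound hu)).2
  have h4 : |u| ^ 4 ≤ u ^ 2 := by
    rw [← sq_abs u]
    exact pow_le_pow_of_le_one (abs_nonneg u) hu (by norm_num)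
  nlinarith [sq_nonneg u]

theorem norm_exp_I_sub_one_sub_le (u : ℝ) :
    ‖Complex.exp (Complex.I * u) - 1 - Complex.I * u‖ ≤ 3 * u ^ 2 := by
  rcases le_total |u| 1 with hu | hu
  · have h := Complex.norm_exp_sub_one_sub_id_le (x := Complex.I * u) (by simpa using hu)
    simp only [norm_mul, Complex.norm_I, one_mul, Complex.norm_real, Real.norm_eq_abs,
      sq_abs] at h
    nlinarith [sq_nonneg u]
  · have h1 : ‖Complex.exp (Complex.I * u) - 1‖ ≤ |u| := Real.norm_exp_I_mul_ofReal_sub_one_le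
    have h2 : ‖Complex.I * (u : ℂ)‖ = |u| := by simp
    have h3 := norm_sub_le (Complex.exp (Complex.I * u) - 1) (Complex.I * u)
    rw [h2] at h3
    have : |u| ≤ u ^ 2 := by
      rw [← sq_abs]; nlinarith
    linarith

/-! ### Integrals with respect to Lévy measures -/

section Levy

variable {m : Measure (Euc d)}

theorem integrable_levy_integrand (hm : Integrable (fun x : Euc d => min 1 (‖x‖ ^ 2)) m)
    (z : Euc d) :
    Integrable (fun x : Euc d =>
      Complex.exp (Complex.I * (⟪z, x⟫_ℝ : ℝ)) - 1 - Complex.I * (⟪z, stdRep x⟫_ℝ : ℝ)) m := by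
  have hstd : Measurable (stdRep : Euc d → Euc d) :=
    Measurable.ite (measurableSet_le measurable_norm measurable_const) measurable_id
      measurable_const
  -- The summand 3‖z‖² serves the unit ball, the summand 2 its complement.
  refine (hm.const_mul (2 + 3 * ‖z‖ ^ 2)).mono' (by fun_prop) (ae_of_all _ fun x => ?_)
  rcases le_or_gt ‖x‖ 1 with hx | hx
  · rw [stdRep, if_pos hx, min_eq_right (pow_le_one₀ (norm_nonneg _) hx)]
    have h1 := norm_exp_I_sub_one_sub_le ⟪z, x⟫_ℝ
    have h2 := inner_sq_le z x
    nlinarith [sq_nonneg ‖x‖]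
  · rw [stdRep, if_neg hx.not_ge, min_eq_left (one_le_pow₀ hx.le)]
    have h1 := norm_sub_le (Complex.exp (Complex.I * (⟪z, x⟫_ℝ : ℝ))) 1
    rw [Complex.norm_exp_I_mul_ofReal, norm_one] at h1
    simp only [inner_zero_right, Complex.ofReal_zero, mul_zero, sub_zero, mul_one]
    nlinarith [sq_nonneg ‖z‖]

/-- The compensator is purely imaginary, so the truncation plays no role in the modulus. -/
theorem re_levy_integrand (z x : Euc d) :
    (Complex.exp (Complex.I * (⟪z, x⟫_ℝ : ℝ)) - 1
      - Complex.I * (⟪z, stdRep x⟫_ℝ : ℝ)).re = -(1 - Real.cos ⟪z, x⟫_ℝ) := by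
  rw [mul_comm Complex.I (⟪z, x⟫_ℝ : ℂ)]
  simp [Complex.exp_ofReal_mul_I_re]

theorem integrable_one_sub_cos (hm : Integrable (fun x : Euc d => min 1 (‖x‖ ^ 2)) m)
    (z : Euc d) : Integrable (fun x : Euc d => 1 - Real.cos ⟪z, x⟫_ℝ) m := by
  refine (integrable_levy_integrand hm z).re.neg.congr (ae_of_all _ fun x => ?_)
  simp only [Pi.neg_apply, RCLike.re_eq_complex_re, re_levy_integrand, neg_neg]

theorem re_integral_levy_integrand (hm : Integrable (fun x : Euc d => min 1 (‖x‖ ^ 2)) m)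
    (z : Euc d) :
    (∫ x, (Complex.exp (Complex.I * (⟪z, x⟫_ℝ : ℝ)) - 1
      - Complex.I * (⟪z, stdRep x⟫_ℝ : ℝ)) ∂m).re = -∫ x, (1 - Real.cos ⟪z, x⟫_ℝ) ∂m := by
  rw [← RCLike.re_eq_complex_re, ← integral_re (integrable_levy_integrand hm z), ← integral_neg]
  simp only [RCLike.re_eq_complex_re, re_levy_integrand]

theorem integrableOn_norm_sq (hm : Integrable (fun x : Euc d => min 1 (‖x‖ ^ 2)) m) (r : ℝ) :
    IntegrableOn (fun x : Euc d => ‖x‖ ^ 2) {x | ‖x‖ ≤ r} m := by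
  -- If the minimum is ‖x‖² the summand 1 suffices; if it is 1, use ‖x‖² ≤ r².
  refine ((hm.const_mul (1 + r ^ 2)).integrableOn (s := {x : Euc d | ‖x‖ ≤ r})).mono'
    (by fun_prop) ?_
  refine (ae_restrict_iff' (measurableSet_le measurable_norm measurable_const)).2
    (ae_of_all _ fun x hx => ?_)
  have hx' : ‖x‖ ^ 2 ≤ r ^ 2 := pow_le_pow_left₀ (norm_nonneg x) hx 2
  rw [Real.norm_of_nonneg (by positivity)]
  rcases min_cases 1 (‖x‖ ^ 2) with ⟨h, _⟩ | ⟨h, _⟩ <;> rw [h] <;> nlinarith [sq_nonneg ‖x‖]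

theorem measure_norm_gt_lt_top (hm : Integrable (fun x : Euc d => min 1 (‖x‖ ^ 2)) m) {r : ℝ}
    (hr : 0 < r) : m {x : Euc d | r < ‖x‖} < ⊤ := by
  have h0 : 0 < min 1 (r ^ 2) := by positivity
  refine lt_of_le_of_lt (measure_mono fun x hx => ?_) (hm.measure_norm_ge_lt_top h0)
  have hx' : r ≤ ‖x‖ := le_of_lt hx
  change min 1 (r ^ 2) ≤ ‖min 1 (‖x‖ ^ 2)‖
  rw [Real.norm_of_nonneg (by positivity)]
  exact min_le_min_left _ (pow_le_pow_left₀ hr.le hx' 2)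

theorem integrableOn_inner_sq (hm : Integrable (fun x : Euc d => min 1 (‖x‖ ^ 2)) m) (r : ℝ)
    (z : Euc d) : IntegrableOn (fun x : Euc d => ⟪z, x⟫_ℝ ^ 2) {x | ‖x‖ ≤ r} m := by
  refine ((integrableOn_norm_sq hm r).const_mul (‖z‖ ^ 2)).mono' (by fun_prop)
    (ae_of_all _ fun x => ?_)
  rw [Real.norm_of_nonneg (sq_nonneg _)]
  exact inner_sq_le z x

theorem quadForm_eq_sum (M : Matrix (Fin d) (Fin d) ℝ) (ξ : Euc d) :
    quadForm M ξ = ∑ i, ∑ j, ξ i * ξ j * M i j := by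
  simp only [quadForm, dotProduct, Matrix.mulVec, Finset.mul_sum]
  exact Finset.sum_congr rfl fun i _ => Finset.sum_congr rfl fun j _ => by ring

theorem quadForm_smul (M : Matrix (Fin d) (Fin d) ℝ) (t : ℝ) (ξ : Euc d) :
    quadForm M (t • ξ) = t ^ 2 * quadForm M ξ := by
  simp only [quadForm_eq_sum, Finset.mul_sum, PiLp.smul_apply, smul_eq_mul]
  exact Finset.sum_congr rfl fun i _ => Finset.sum_congr rfl fun j _ => by ring

theorem quadForm_truncMoment (hm : Integrable (fun x : Euc d => min 1 (‖x‖ ^ 2)) m) (r : ℝ)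
    (ξ : Euc d) :
    quadForm (truncMoment m r) ξ = ∫ x in {x : Euc d | ‖x‖ ≤ r}, ⟪ξ, x⟫_ℝ ^ 2 ∂m := by
  have hint : ∀ i j : Fin d,
      Integrable (fun x : Euc d => x i * x j) (m.restrict {x : Euc d | ‖x‖ ≤ r}) := by
    intro i j
    refine Integrable.mono' (integrableOn_norm_sq hm r) (by fun_prop) (ae_of_all _ fun x => ?_)
    rw [norm_mul, sq]
    exact mul_le_mul (PiLp.norm_apply_le x i) (PiLp.norm_apply_le x j) (norm_nonneg _)
      (norm_nonneg _)
  have e : ∀ x : Euc d, ⟪ξ, x⟫_ℝ ^ 2 = ∑ i, ∑ j, ξ i * ξ j * (x i * x j) := by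
    intro x
    rw [PiLp.inner_apply, sq, Finset.sum_mul_sum]
    refine Finset.sum_congr rfl fun i _ => Finset.sum_congr rfl fun j _ => ?_
    simp only [RCLike.inner_apply, conj_trivial]
    ring
  simp only [e]
  rw [integral_finsetSum _ fun i _ => integrable_finsetSum _ fun j _ => (hint i j).const_mul _,
    quadForm_eq_sum]
  refine Finset.sum_congr rfl fun i _ => ?_
  rw [integral_finsetSum _ fun j _ => (hint i j).const_mul _]
  exact Finset.sum_congr rfl fun j _ => by rw [integral_const_mul, truncMoment, Matrix.of_apply]

theorem quadForm_truncMoment_nonneg (hm : Integrable (fun x : Euc d => min 1 (‖x‖ ^ 2)) m)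
    (r : ℝ) (ξ : Euc d) : 0 ≤ quadForm (truncMoment m r) ξ := by
  rw [quadForm_truncMoment hm]
  exact integral_nonneg fun x => sq_nonneg _

theorem quadForm_truncMoment_le (hm : Integrable (fun x : Euc d => min 1 (‖x‖ ^ 2)) m)
    (r : ℝ) (ξ : Euc d) :
    quadForm (truncMoment m r) ξ ≤ ‖ξ‖ ^ 2 * ∫ x in {x : Euc d | ‖x‖ ≤ r}, ‖x‖ ^ 2 ∂m := by
  rw [quadForm_truncMoment hm, ← integral_const_mul]
  exact integral_mono (integrableOn_inner_sq hm r ξ) ((integrableOn_norm_sq hm r).const_mul _)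
    fun x => inner_sq_le ξ x

theorem exists_sphere_smul {z : Euc d} (hz : z ≠ 0) :
    ∃ ξ : Metric.sphere (0 : Euc d) 1, z = ‖z‖ • (ξ : Euc d) := by
  have h : ‖z‖ ≠ 0 := norm_ne_zero_iff.2 hz
  refine ⟨⟨‖z‖⁻¹ • z, by simp [norm_smul, h]⟩, ?_⟩
  simp [smul_smul, h]

theorem norm_sq_mul_iInf_le (hm : Integrable (fun x : Euc d => min 1 (‖x‖ ^ 2)) m) (r : ℝ)
    {z : Euc d} (hz : z ≠ 0) :
    ‖z‖ ^ 2 * (⨅ ξ : Metric.sphere (0 : Euc d) 1, quadForm (truncMoment m r) (ξ : Euc d))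
      ≤ quadForm (truncMoment m r) z := by
  obtain ⟨ξ, hξ⟩ := exists_sphere_smul hz
  conv_rhs => rw [hξ, quadForm_smul]
  refine mul_le_mul_of_nonneg_left (ciInf_le ⟨0, ?_⟩ ξ) (sq_nonneg _)
  rintro _ ⟨η, rfl⟩
  exact quadForm_truncMoment_nonneg hm r _

theorem le_norm_sq_mul_iSup (hm : Integrable (fun x : Euc d => min 1 (‖x‖ ^ 2)) m) (r : ℝ)
    {z : Euc d} (hz : z ≠ 0) :
    quadForm (truncMoment m r) z ≤
      ‖z‖ ^ 2 * (⨆ ξ : Metric.sphere (0 : Euc d) 1, quadForm (truncMoment m r) (ξ : Euc d)) := by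
  obtain ⟨ξ, hξ⟩ := exists_sphere_smul hz
  conv_lhs => rw [hξ, quadForm_smul]
  refine mul_le_mul_of_nonneg_left
    (le_ciSup (f := fun ξ : Metric.sphere (0 : Euc d) 1 => quadForm (truncMoment m r) (ξ : Euc d))
      ⟨∫ x in {x : Euc d | ‖x‖ ≤ r}, ‖x‖ ^ 2 ∂m, ?_⟩ ξ) (sq_nonneg _)
  rintro _ ⟨η, rfl⟩
  simpa using quadForm_truncMoment_le hm r (η : Euc d)

theorem abs_inner_le_one_of_norm_le {z x : Euc d} (hx : ‖x‖ ≤ ‖z‖⁻¹) : |⟪z, x⟫_ℝ| ≤ 1 := by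
  rcases eq_or_ne z 0 with rfl | hz
  · simp
  · calc |⟪z, x⟫_ℝ| ≤ ‖z‖ * ‖x‖ := abs_real_inner_le_norm z x
      _ ≤ ‖z‖ * ‖z‖⁻¹ := by gcongr
      _ = 1 := mul_inv_cancel₀ (norm_ne_zero_iff.2 hz)

/-- On the ball of radius 1/‖z‖ the phase ⟨z,x⟩ is at most 1 in modulus, so the quadratic lower
bound applies; the nonnegative rest is dropped. At z = 0 the radius is 0 by convention. -/
theorem le_integral_one_sub_cos (hm : Integrable (fun x : Euc d => min 1 (‖x‖ ^ 2)) m)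
    (z : Euc d) :
    quadForm (truncMoment m ‖z‖⁻¹) z / 3 ≤ ∫ x, (1 - Real.cos ⟪z, x⟫_ℝ) ∂m := by
  have hi := integrable_one_sub_cos hm z
  rw [quadForm_truncMoment hm, ← integral_div]
  refine le_trans ?_ (setIntegral_le_integral (s := {x : Euc d | ‖x‖ ≤ ‖z‖⁻¹}) hi
    (ae_of_all _ fun x => one_sub_cos_nonneg _))
  exact setIntegral_mono_on ((integrableOn_inner_sq hm _ z).div_const 3) hi.integrableOn
    (measurableSet_le measurable_norm measurable_const)
    fun x hx => sq_div_three_le_one_sub_cos (abs_inner_le_one_of_norm_le hx)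

theorem integral_one_sub_cos_le (hm : Integrable (fun x : Euc d => min 1 (‖x‖ ^ 2)) m)
    (z : Euc d) {r : ℝ} (hr : 0 < r) :
    ∫ x, (1 - Real.cos ⟪z, x⟫_ℝ) ∂m
      ≤ quadForm (truncMoment m r) z / 2 + 2 * m.real {x : Euc d | r < ‖x‖} := by
  have hi := integrable_one_sub_cos hm z
  have hs : MeasurableSet {x : Euc d | ‖x‖ ≤ r} :=
    measurableSet_le measurable_norm measurable_const
  have hc : {x : Euc d | ‖x‖ ≤ r}ᶜ = {x : Euc d | r < ‖x‖} := by
    ext x; simp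
  rw [← integral_add_compl hs hi, hc, quadForm_truncMoment hm, ← integral_div]
  have hfin := measure_norm_gt_lt_top hm hr
  refine add_le_add ?_ ?_
  · exact integral_mono hi.integrableOn ((integrableOn_inner_sq hm _ z).div_const 2)
      fun x => one_sub_cos_le_sq _
  · have h := setIntegral_mono (μ := m) (s := {x : Euc d | r < ‖x‖}) hi.integrableOn
      (integrableOn_const (C := (2 : ℝ)) hfin.ne) fun x => one_sub_cos_le_two ⟪z, x⟫_ℝ
    rw [setIntegral_const, smul_eq_mul] at h
    linarith

/-- After division by R² = ‖z‖², the integrand is at most min(‖x‖²/2, 2/R²), which tends to 0 and,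
for R ≥ 2, is dominated by min(1, ‖x‖²). The bound depends on ‖z‖ only, hence is uniform in the
direction of z. -/
theorem exists_tendsto_zero_bound_one_sub_cos
    (hm : Integrable (fun x : Euc d => min 1 (‖x‖ ^ 2)) m) :
    ∃ φ : ℝ → ℝ, Tendsto φ atTop (𝓝 0) ∧
      ∀ z : Euc d, 2 ≤ ‖z‖ → ∫ x, (1 - Real.cos ⟪z, x⟫_ℝ) ∂m ≤ ‖z‖ ^ 2 * φ ‖z‖ := by
  have hdom : ∀ R : ℝ, 2 ≤ R → ∀ x : Euc d,
      ‖min (‖x‖ ^ 2 / 2) (2 / R ^ 2)‖ ≤ min 1 (‖x‖ ^ 2) := by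
    intro R hR x
    rw [Real.norm_of_nonneg (by positivity), min_comm 1]
    refine min_le_min (by linarith [sq_nonneg ‖x‖]) ?_
    rw [div_le_one (by positivity)]
    nlinarith
  refine ⟨fun R => ∫ x, min (‖x‖ ^ 2 / 2) (2 / R ^ 2) ∂m, ?_, ?_⟩
  · have h := tendsto_integral_filter_of_dominated_convergence (μ := m) (l := atTop)
      (F := fun (R : ℝ) (x : Euc d) => min (‖x‖ ^ 2 / 2) (2 / R ^ 2)) (f := fun _ => (0 : ℝ))
      (fun x : Euc d => min 1 (‖x‖ ^ 2))
      (Eventually.of_forall fun R => by fun_prop)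
      ((eventually_ge_atTop 2).mono fun R hR => ae_of_all _ (hdom R hR)) hm
      (ae_of_all _ fun x => ?_)
    · simpa using h
    · refine squeeze_zero (g := fun R : ℝ => 2 / R ^ 2) (fun R => by positivity)
        (fun R => min_le_right _ _) ?_
      exact tendsto_const_nhds.div_atTop (tendsto_pow_atTop two_ne_zero)
  · intro z hz
    rw [← integral_const_mul]
    have hz0 : ‖z‖ ≠ 0 := by positivity
    refine integral_mono (integrable_one_sub_cos hm z) ?_ fun x => ?_
    · exact (hm.mono' (by fun_prop) (ae_of_all _ (hdom ‖z‖ hz))).const_mul _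
    · simp only
      rw [mul_min_of_nonneg _ _ (sq_nonneg ‖z‖)]
      refine le_min ?_ ?_
      · linarith [one_sub_cos_le_sq ⟪z, x⟫_ℝ, inner_sq_le z x]
      · rw [mul_div_cancel₀ _ (by positivity)]
        exact one_sub_cos_le_two _

end Levy
/-! ### Decay of the characteristic function -/

theorem AwaySignedMeasure.IsQuasiLevyType.integrable_posPart {ν : AwaySignedMeasure d}
    (h : ν.IsQuasiLevyType) : MeasureTheory.Integrable (fun x : Euc d => min 1 (‖x‖ ^ 2)) ν.posPart := by
  have h1 : MeasureTheory.Integrable (fun x : Euc d => ((min 1 (‖x‖ ^ 2) : ℝ) : ℂ)) ν.posPart :=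
    (integrable_add_measure.1 h).1
  exact h1.re

theorem AwaySignedMeasure.IsQuasiLevyType.integrable_negPart {ν : AwaySignedMeasure d}
    (h : ν.IsQuasiLevyType) : MeasureTheory.Integrable (fun x : Euc d => min 1 (‖x‖ ^ 2)) ν.negPart := by
  have h1 : MeasureTheory.Integrable (fun x : Euc d => ((min 1 (‖x‖ ^ 2) : ℝ) : ℂ)) ν.negPart :=
    (integrable_add_measure.1 h).2
  exact h1.re

theorem re_charExponent (A : Matrix (Fin d) (Fin d) ℝ) {ν : AwaySignedMeasure d}
    (hν : ν.IsQuasiLevyType) (γ z : Euc d) :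
    (charExponent A ν γ z).re = -(quadForm A z / 2) - ∫ x, (1 - Real.cos ⟪z, x⟫_ℝ) ∂ν.posPart
      + ∫ x, (1 - Real.cos ⟪z, x⟫_ℝ) ∂ν.negPart := by
  have h1 : (Complex.I * (⟪γ, z⟫_ℝ : ℝ)).re = 0 := by simp
  have h2 : ((1 / 2 : ℂ) * (quadForm A z : ℝ)).re = quadForm A z / 2 := by
    rw [mul_comm, Complex.re_ofReal_mul]
    norm_num
    ring
  rw [charExponent, AwaySignedMeasure.integral, Complex.add_re, Complex.sub_re, Complex.sub_re,
    re_integral_levy_integrand hν.integrable_posPart,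
    re_integral_levy_integrand hν.integrable_negPart, h1, h2]
  ring

variable {μ : Measure (Euc d)} {A : Matrix (Fin d) (Fin d) ℝ} {ν : AwaySignedMeasure d}
  {γ : Euc d}

theorem HasCharacteristicTriplet.norm_charFun (h : HasCharacteristicTriplet μ A ν γ) (z : Euc d) :
    ‖charFun μ z‖ = Real.exp (charExponent A ν γ z).re := by
  rw [h.charFun_eq, Complex.norm_exp]

/-- The Gaussian covariance matrix in the characteristic triplet of a probability measure is
positive semidefinite. -/
theorem HasCharacteristicTriplet.quadForm_nonneg [IsProbabilityMeasure μ]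
    (h : HasCharacteristicTriplet μ A ν γ) (z : Euc d) : 0 ≤ quadForm A z := by
  rcases eq_or_ne z 0 with rfl | hz
  · simp [quadForm_eq_sum]
  have hz' : 0 < ‖z‖ := norm_pos_iff.2 hz
  obtain ⟨φ, hφ, hle⟩ := exists_tendsto_zero_bound_one_sub_cos h.levy.integrable_posPart
  -- Along the ray t • z the real part of the exponent is at most 0, so ⟨z,Az⟩ is bounded below by
  -- this quantity.
  have hlim : Tendsto (fun t : ℝ => -(2 * ‖z‖ ^ 2 * φ (t * ‖z‖))) atTop (𝓝 0) := by
    have := ((hφ.comp (tendsto_id.atTop_mul_const hz')).const_mul (2 * ‖z‖ ^ 2)).neg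
    simpa using this
  refine le_of_tendsto hlim ?_
  filter_upwards [eventually_ge_atTop (2 / ‖z‖), eventually_gt_atTop 0] with t ht ht0
  have hn : ‖t • z‖ = t * ‖z‖ := by rw [norm_smul, Real.norm_of_nonneg ht0.le]
  have h1 := hle (t • z) (by rw [hn]; exact (div_le_iff₀ hz').1 ht)
  have h2 : (charExponent A ν γ (t • z)).re ≤ 0 := by
    rw [← Real.exp_le_one_iff, ← h.norm_charFun]
    exact norm_charFun_le_one _
  rw [re_charExponent A h.levy, quadForm_smul] at h2
  have h3 : 0 ≤ ∫ x, (1 - Real.cos ⟪t • z, x⟫_ℝ) ∂ν.negPart :=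
    integral_nonneg fun x => one_sub_cos_nonneg _
  rw [hn] at h1
  have h4 : 0 ≤ t ^ 2 * (quadForm A z + 2 * ‖z‖ ^ 2 * φ (t * ‖z‖)) := by nlinarith
  linarith [nonneg_of_mul_nonneg_right h4 (by positivity)]

theorem continuous_quadForm (M : Matrix (Fin d) (Fin d) ℝ) :
    Continuous fun ξ : Euc d => quadForm M ξ := by
  simp only [quadForm_eq_sum]
  fun_prop

theorem exists_pos_mul_norm_sq_le_quadForm (hA : A.PosDef) :
    ∃ c : ℝ, 0 < c ∧ ∀ z : Euc d, c * ‖z‖ ^ 2 ≤ quadForm A z := by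
  have hpos : ∀ z : Euc d, z ≠ 0 → 0 < quadForm A z := by
    intro z hz
    have := hA.dotProduct_mulVec_pos (x := z.ofLp) (by simpa using hz)
    simpa [quadForm] using this
  -- The sphere is empty when d = 0; otherwise c is the minimum of the form on it.
  rcases (Metric.sphere (0 : Euc d) 1).eq_empty_or_nonempty with he | hne
  · refine ⟨1, one_pos, fun z => ?_⟩
    rcases eq_or_ne z 0 with rfl | hz
    · simp [quadForm_eq_sum]
    · obtain ⟨ξ, -⟩ := exists_sphere_smul hz
      exact absurd ξ.2 (by simp [he])
  · obtain ⟨ξ₀, hξ₀, hmin⟩ := (isCompact_sphere (0 : Euc d) 1).exists_isMinOn hne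
      (continuous_quadForm A).continuousOn
    refine ⟨quadForm A ξ₀, hpos ξ₀ (ne_zero_of_mem_unit_sphere ⟨ξ₀, hξ₀⟩), fun z => ?_⟩
    rcases eq_or_ne z 0 with rfl | hz
    · simp [quadForm_eq_sum]
    · obtain ⟨ξ, hξ⟩ := exists_sphere_smul hz
      conv_rhs => rw [hξ, quadForm_smul, mul_comm]
      exact mul_le_mul_of_nonneg_right (hmin ξ.2) (sq_nonneg _)

theorem HasCharacteristicTriplet.eventually_re_le_of_posDef
    (h : HasCharacteristicTriplet μ A ν γ) (hA : A.PosDef) (n : ℕ) :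
    ∀ᶠ z in cocompact (Euc d), (charExponent A ν γ z).re ≤ -(n * Real.log ‖z‖) := by
  obtain ⟨c, hc, hq⟩ := exists_pos_mul_norm_sq_le_quadForm hA
  obtain ⟨φ, hφ, hle⟩ := exists_tendsto_zero_bound_one_sub_cos h.levy.integrable_negPart
  have hR := tendsto_norm_cocompact_atTop (E := Euc d)
  -- The Gaussian gain c‖z‖²/2 is split in halves: one absorbs the ν⁻ integral, the other n log‖z‖ ≤
  -- n‖z‖.
  filter_upwards [hR.eventually (hφ.eventually_le_const (by positivity : 0 < c / 4)),
    hR.eventually (eventually_ge_atTop 2), hR.eventually (eventually_ge_atTop (4 * n / c))]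
    with z h1 h2 h3
  have h4 := hle z h2
  have h5 : 0 ≤ ∫ x, (1 - Real.cos ⟪z, x⟫_ℝ) ∂ν.posPart :=
    integral_nonneg fun x => one_sub_cos_nonneg _
  have h6 : Real.log ‖z‖ ≤ ‖z‖ := Real.log_le_self (norm_nonneg z)
  have h7 : (n : ℝ) * Real.log ‖z‖ ≤ n * ‖z‖ := by gcongr
  have h8 : (n : ℝ) * ‖z‖ ≤ c / 4 * ‖z‖ ^ 2 := by
    rw [div_le_iff₀ hc] at h3
    nlinarith
  have h9 : ‖z‖ ^ 2 * φ ‖z‖ ≤ ‖z‖ ^ 2 * (c / 4) := by gcongr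
  rw [re_charExponent A h.levy]
  linarith [hq z]

theorem HasCharacteristicTriplet.eventually_re_le_of_kallenbergCondition [IsProbabilityMeasure μ]
    (h : HasCharacteristicTriplet μ A ν γ) (hν : KallenbergCondition ν) (n : ℕ) :
    ∀ᶠ z in cocompact (Euc d), (charExponent A ν γ z).re ≤ -(n * Real.log ‖z‖) := by
  have hR := tendsto_norm_cocompact_atTop (E := Euc d)
  -- The threshold n + 1 is positive even for n = 0, which excludes G⁺ = 0, where the expression has
  -- the value 0.
  have hK := (hν.comp (tendsto_inv_atTop_nhdsGT_zero.comp hR)).eventually_ge_atTop ((n : ℝ) + 1)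
  filter_upwards [hK, hR.eventually (eventually_ge_atTop 2)] with z hz h2
  simp only [Function.comp_apply] at hz
  have hz0 : 0 < ‖z‖ := by linarith
  have hzne : z ≠ 0 := norm_pos_iff.1 hz0
  have hlog : 0 < Real.log ‖z‖ := Real.log_pos (by linarith)
  have hG : Gplus ν ‖z‖⁻¹ ≠ 0 := by
    intro h0
    rw [h0] at hz
    simp only [mul_zero, zero_mul] at hz
    linarith [(Nat.cast_nonneg n : (0 : ℝ) ≤ n)]
  have e : ((‖z‖⁻¹) ^ 2)⁻¹ * |Real.log ‖z‖⁻¹|⁻¹ * Gplus ν ‖z‖⁻¹ *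
      (1 / 3 - 2 * ((‖z‖⁻¹) ^ 2 * ν.negPart.real {x : Euc d | ‖z‖⁻¹ < ‖x‖} / Gplus ν ‖z‖⁻¹)
        - 2 / 3 * (Gminus ν ‖z‖⁻¹ / Gplus ν ‖z‖⁻¹)) =
      (‖z‖ ^ 2 * Gplus ν ‖z‖⁻¹ / 3 - 2 * ν.negPart.real {x : Euc d | ‖z‖⁻¹ < ‖x‖}
        - 2 / 3 * (‖z‖ ^ 2 * Gminus ν ‖z‖⁻¹)) / Real.log ‖z‖ := by
    rw [Real.log_inv, abs_neg, abs_of_pos hlog]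
    generalize Gplus ν ‖z‖⁻¹ = a at hG ⊢
    generalize Gminus ν ‖z‖⁻¹ = b
    generalize ν.negPart.real {x : Euc d | ‖z‖⁻¹ < ‖x‖} = c
    field_simp
  rw [e, le_div_iff₀ hlog] at hz
  have hpos := h.levy.integrable_posPart
  have hneg := h.levy.integrable_negPart
  have h3 := le_integral_one_sub_cos hpos z
  have h4 := integral_one_sub_cos_le hneg z (inv_pos.2 hz0)
  have h5 : ‖z‖ ^ 2 * Gplus ν ‖z‖⁻¹ ≤ quadForm (truncMoment ν.posPart ‖z‖⁻¹) z :=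
    norm_sq_mul_iInf_le hpos _ hzne
  have h6 : quadForm (truncMoment ν.negPart ‖z‖⁻¹) z ≤ ‖z‖ ^ 2 * Gminus ν ‖z‖⁻¹ :=
    le_norm_sq_mul_iSup hneg _ hzne
  have h7 := quadForm_truncMoment_nonneg hneg ‖z‖⁻¹ z
  rw [re_charExponent A h.levy]
  -- The upper bound carries the factor 1/2 on the ν⁻ form, the condition 2/3; nonnegativity of the
  -- form (`h7`) bridges the gap.
  linarith [h.quadForm_nonneg z]

/-- Decay of order n + d + 1 leaves ‖z‖^(-(d+1)), integrable at infinity in dimension d. The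
constant 2^(d+1) comes from 1 + ‖z‖ ≤ 2‖z‖. -/
theorem integrable_norm_pow_mul_norm_charFun [IsFiniteMeasure μ]
    (hμ : ∀ n : ℕ, ∀ᶠ z in cocompact (Euc d),
      ‖charFun μ z‖ ≤ Real.exp (-(n * Real.log ‖z‖))) (n : ℕ) :
    Integrable fun z : Euc d => ‖z‖ ^ n * ‖charFun μ z‖ := by
  have hcont : Continuous fun z : Euc d => ‖z‖ ^ n * ‖charFun μ z‖ := by
    have : Continuous (charFun μ) := continuous_charFun
    fun_prop
  have hint : Integrable fun z : Euc d => (1 + ‖z‖) ^ (-((d + 1 : ℕ) : ℝ)) :=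
    integrable_one_add_norm (by simp)
  refine hcont.locallyIntegrable.integrable_of_isBigO_cocompact (Asymptotics.IsBigO.of_bound
    (2 ^ (d + 1)) ?_) (hint.integrableAtFilter _)
  have hR := tendsto_norm_cocompact_atTop (E := Euc d)
  filter_upwards [hμ (n + (d + 1)), hR.eventually (eventually_ge_atTop 1)] with z hz h1
  have hz0 : 0 < ‖z‖ := by linarith
  have e : Real.exp (-(((n + (d + 1) : ℕ) : ℝ) * Real.log ‖z‖)) = (‖z‖ ^ (n + (d + 1)))⁻¹ := by
    rw [Real.exp_neg, mul_comm, ← Real.rpow_def_of_pos hz0, Real.rpow_natCast]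
  rw [e] at hz
  rw [Real.norm_of_nonneg (by positivity), Real.norm_of_nonneg (by positivity),
    Real.rpow_neg (by positivity), Real.rpow_natCast]
  calc ‖z‖ ^ n * ‖charFun μ z‖ ≤ ‖z‖ ^ n * (‖z‖ ^ (n + (d + 1)))⁻¹ := by gcongr
    _ = (‖z‖ ^ (d + 1))⁻¹ := by rw [pow_add]; field_simp
    _ = 2 ^ (d + 1) * ((2 * ‖z‖) ^ (d + 1))⁻¹ := by rw [mul_pow]; field_simp
    _ ≤ 2 ^ (d + 1) * ((1 + ‖z‖) ^ (d + 1))⁻¹ := by gcongr; linarith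

end QID

theorem theorem4p1 {d : ℕ} (μ : Measure (QID.Euc d)) (A : Matrix (Fin d) (Fin d) ℝ)
    (ν : QID.AwaySignedMeasure d) (γ : QID.Euc d)
    (hμ : QID.IsQuasiInfinitelyDivisible μ)
    (htriplet : QID.HasCharacteristicTriplet μ A ν γ)
    (hcond : A.PosDef ∨ QID.KallenbergCondition ν) :
    ∃ f : QID.Euc d → ℝ,
      (∀ x, 0 ≤ f x) ∧ ContDiff ℝ ∞ f ∧
      μ = volume.withDensity (fun x => ENNReal.ofReal (f x)) ∧
      ∀ k : ℕ, Tendsto (fun x => iteratedFDeriv ℝ k f x) (cocompact (QID.Euc d)) (𝓝 0) := by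
  have := hμ.1
  refine exists_contDiff_density_of_integrable_charFun μ
    (QID.integrable_norm_pow_mul_norm_charFun fun n => ?_)
  have hre : ∀ᶠ z in cocompact (QID.Euc d),
      (QID.charExponent A ν γ z).re ≤ -(n * Real.log ‖z‖) := by
    rcases hcond with hA | hν
    · exact htriplet.eventually_re_le_of_posDef hA n
    · exact htriplet.eventually_re_le_of_kallenbergCondition hν n
  filter_upwards [hre] with z hz
  rw [htriplet.norm_charFun]
  exact Real.exp_le_exp.2 hz
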